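/- For a topological space $X$ let $x\le y$ mean that every open set containing $x$ contains $y$ (the specialization preorder), and for $U\subseteq X$ put $$\mathord{\downarrow}U=\{x\in X\mid x\le y\text{ for some }y\in U\},\qquad \mathord{\Uparrow}U=\{x\in X\mid y\in U\text{ for all }y\ge x\}.$$ Let $\mathsf{RO}(X)$ be the Boolean algebra of regular open subsets of $X$, and for $U,V\in\mathsf{RO}(X)$ write $U\ll V$ if $\overline U\subseteq\mathord{\downarrow}V$. For a proper filter $F$ on $\mathsf{RO}(X)$ let $F^{\circ}=\{V\in F\mid U\ll V\text{ for some }U\in F\}$; $F$ is called concordant if $F^{\circ}=F$. For $x\in X$ let $\mathsf{RO}(x)=\{U\in\mathsf{RO}(X)\mid x\in U\}$. A topological space $X$ is a *$dV$-space* (de Vries space) if: 1. $X$ is $T_0$, compact (every open cover has a finite subcover), and order-normal: whenever $A$ is closed, $B$ is regular closed and $A\cap\mathord{\Uparrow}B=\emptyset$, there are disjoint open sets $U,V$ with $A\subseteq\mathord{\downarrow}U$ and $\mathord{\Uparrow}B\subseteq V$; 2. $\mathsf{RO}(X)$ is a basis of the topology of $X$, and $\mathord{\Uparrow}\mathord{\downarrow}U=U$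 for every $U\in\mathsf{RO}(X)$; 3. for every $x\in X$, $\mathsf{RO}(x)$ is a concordant (proper) filter on $\mathsf{RO}(X)$, and for every proper filter $F$ on $\mathsf{RO}(X)$ there is $x\in X$ with $F^{\circ}=\mathsf{RO}(x)$. Let $L$ be a frame (locale), with pseudo-complement $\neg$. It is compact if every $S\subseteq L$ with $\bigvee S=1$ has a finite subset $T$ with $\bigvee T=1$; it is regular if $a=\bigvee\{b\in L\mid a\vee\neg b=1\}$ for every $a\in L$. The *upper Vietoris space* $UV(L)$ of a compact regular locale $L$ is the set $L\setminus\{1\}$ with the topology generated by the sets $\Box a=\{b\in L\setminus\{1\}\mid a\vee b=1\}$, $a\in L$. **Theorem.** A topological space is a $dV$-space if and only if it is homeomorphic to the upper Vietoris space of a compact regular locale. -/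

import Mathlib

open TopologicalSpace

universe u

section Spaces

variable {X : Type u} [TopologicalSpace X]

/-- The specialization preorder `x ≤ y`: every open set that contains `x` contains `y`. -/
def SpecLE (x y : X) : Prop :=
  ∀ U : Set X, IsOpen U → x ∈ U → y ∈ U

/-- The downset generated by `U` in the specialization preorder, that is, the closure of `U` in
the topology of all upward closed sets. -/
def downSet (U : Set X) : Set X :=
  {x | ∃ y ∈ U, SpecLE x y}

/-- The largest upward closed subset of `U` in the specialization preorder, that is, the interior
of `U` in the topology of all upward closed sets. -/
def upInterior (U : Set X) : Set X :=
  {x | ∀ y, SpecLE x y → y ∈ U}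

/-- `U` is order-regular open: it equals the interior of its closure in the topology of all
upward closed sets. -/
def IsOrderRegularOpen (U : Set X) : Prop :=
  upInterior (downSet U) = U

/-- `B` is regular closed: it is the closure of its interior. -/
def IsRegularClosed (B : Set X) : Prop :=
  closure (interior B) = B

variable (X)

/-- The Boolean algebra of regular open subsets of `X`. In the frame `Opens X` the pseudo-complement
of `U` is the complement of the closure of `U`, so the regular elements are the regular open sets. -/
abbrev RO : Type u := Heyting.Regular (Opens X)

/-- Order-normality. -/
def IsOrderNormal : Prop :=
  ∀ A B : Set X, IsClosed A → IsRegularClosed B → Disjoint A (upInterior B) →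
    ∃ U V : Set X, IsOpen U ∧ IsOpen V ∧ Disjoint U V ∧ A ⊆ downSet U ∧ upInterior B ⊆ V

variable {X}

/-- A regular open set, seen as a set of points. -/
def RO.toSet (U : RO X) : Set X := ((U : Opens X) : Set X)

/-- The relation `U ≪ V` on regular open sets: the closure of `U` lies in the downset of `V`. -/
def RO.WellBelow (U V : RO X) : Prop :=
  closure U.toSet ⊆ downSet V.toSet

/-- The set of the regular open sets that contain the point `x`. -/
def RO.nhd (x : X) : Set (RO X) :=
  {U | x ∈ U.toSet}

end Spaces

section Filters

variable {B : Type u} [BooleanAlgebra B]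

/-- Proper filters of a Boolean algebra. -/
def IsProperFilter (F : Set B) : Prop :=
  Order.IsPFilter F ∧ ⊥ ∉ F

/-- The elements `a` of `F` such that `b ≺ a` for some `b` in `F`. -/
def roundPart (prec : B → B → Prop) (F : Set B) : Set B :=
  {a | a ∈ F ∧ ∃ b ∈ F, prec b a}

/-- Concordant filters of a Boolean algebra with a relation `≺`. -/
def IsConcordantFilter (prec : B → B → Prop) (F : Set B) : Prop :=
  IsProperFilter F ∧ roundPart prec F = F

end Filters

/-- De Vries spaces (`dV`-spaces). -/
structure IsDVSpace (X : Type u) [TopologicalSpace X] : Prop where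
  t0 : T0Space X
  compact : CompactSpace X
  orderNormal : IsOrderNormal X
  basis : Opens.IsBasis {U : Opens X | Heyting.IsRegular U}
  orderRegular : ∀ U : RO X, IsOrderRegularOpen U.toSet
  concordant : ∀ x : X, IsConcordantFilter RO.WellBelow (RO.nhd x)
  realized : ∀ F : Set (RO X), IsProperFilter F → ∃ x : X, roundPart RO.WellBelow F = RO.nhd x

section Frames

variable {L : Type u} [Order.Frame L]

/-- `a` is rather below `b`; here `aᶜ` is the pseudo-complement of `a`. -/
def RatherBelow (a b : L) : Prop :=
  b ⊔ aᶜ = ⊤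

variable (L)

/-- Compact frames. -/
def IsCompactFrame : Prop :=
  ∀ S : Set L, sSup S = ⊤ → ∃ T ⊆ S, T.Finite ∧ sSup T = ⊤

/-- Regular frames: every element is the join of the elements rather below it. -/
def IsRegularFrame : Prop :=
  ∀ a : L, a = sSup {b | RatherBelow b a}

/-- The points of the upper Vietoris space of `L`: the elements of `L` other than the top. -/
def UpperVietoris : Type u := {b : L // b ≠ ⊤}

variable {L}

/-- The set `□ a` of all points `b` with `a ∨ b = 1`. -/
def UpperVietoris.box (a : L) : Set (UpperVietoris L) :=
  {b | a ⊔ b.1 = ⊤}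

/-- The topology generated by the sets `□ a`. -/
instance UpperVietoris.instTopologicalSpace : TopologicalSpace (UpperVietoris L) :=
  generateFrom (Set.range UpperVietoris.box)

end Frames

/-! A `dV`-space is recovered from the pair (`RO X`, `≪`). The space axioms make `≪` a proximity on
the Boolean algebra `RO X` (`IsDVSpace.isProximity`), and the round ideals of any proximity form a
compact regular frame. A point `x` gives the round ideal of all `U` with `Uᶜ ∈ RO(x)`; concordance
makes it round, and realization of filters makes every proper round ideal arise this way. A box
pulls back to the union of the members of an ideal, so the bijection is a homeomorphism.

Conversely, in `UV(L)` the specialization order is the order of `L`, and `↓□a` consists of the `c`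
with `a ≰ c`. Since `□` preserves meets and pseudo-complements, the regular opens are the boxes of
regular elements, and `≪` between them is the rather below relation (`regularBox_wellBelow`). The
space axioms thereby become statements about `L`, settled by compactness and regularity. -/

/-! ### The compact regular frame of round ideals of a proximity -/

section RoundIdeals

variable {B : Type u} [BooleanAlgebra B]

/-- Interpolative proximity relations on a Boolean algebra: the axioms of a de Vries algebra other
than the approximation of an element by the elements below it. -/
class IsProximity (prec : B → B → Prop) : Prop where
  bot : prec ⊥ ⊥
  le {a b : B} : prec a b → a ≤ b
  mono {a b c d : B} : a ≤ b → prec b c → c ≤ d → prec a d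
  sup {a b c : B} : prec a c → prec b c → prec (a ⊔ b) c
  compl {a b : B} : prec a b → prec bᶜ aᶜ
  interp {a b : B} : prec a b → ∃ c, prec a c ∧ prec c b

namespace IsProximity

variable {prec : B → B → Prop} [IsProximity prec]

theorem inf {a b c : B} (hb : prec a b) (hc : prec a c) : prec a (b ⊓ c) := by
  have h := compl (sup (compl hb) (compl hc))
  rwa [compl_sup, compl_compl, compl_compl, compl_compl] at h

theorem sup_sup {a b c d : B} (h : prec a c) (h' : prec b d) : prec (a ⊔ b) (c ⊔ d) :=
  sup (mono le_rfl h le_sup_left) (mono le_rfl h' le_sup_right)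

end IsProximity

/-- The round ideals of a Boolean algebra with a relation `≺`. -/
structure RoundIdeal (prec : B → B → Prop) where
  /-- The set of elements of the ideal. -/
  carrier : Set B
  bot_mem : ⊥ ∈ carrier
  lower {a b : B} : a ≤ b → b ∈ carrier → a ∈ carrier
  sup_mem {a b : B} : a ∈ carrier → b ∈ carrier → a ⊔ b ∈ carrier
  round {a : B} : a ∈ carrier → ∃ b ∈ carrier, prec a b

namespace RoundIdeal

variable {prec : B → B → Prop}

theorem eq_of_carrier_eq {I J : RoundIdeal prec} (h : I.carrier = J.carrier) : I = J := by
  cases I; cases J; cases h; rfl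

instance : PartialOrder (RoundIdeal prec) :=
  PartialOrder.lift carrier fun _ _ => eq_of_carrier_eq

theorem le_def {I J : RoundIdeal prec} : I ≤ J ↔ I.carrier ⊆ J.carrier := Iff.rfl

theorem finset_sup_mem (I : RoundIdeal prec) {T : Finset B} (h : ∀ t ∈ T, t ∈ I.carrier) :
    T.sup id ∈ I.carrier :=
  Finset.sup_induction I.bot_mem (fun _ ha _ hb => I.sup_mem ha hb) h

variable [IsProximity prec]

/-- The ideal generated by the union is already round: each element of a finite set `T` can be
enlarged inside its own ideal, and `≺` is compatible with finite joins. -/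
instance : SupSet (RoundIdeal prec) where
  sSup S :=
    { carrier := {a | ∃ T : Finset B, (∀ t ∈ T, ∃ I ∈ S, t ∈ I.carrier) ∧ a ≤ T.sup id}
      bot_mem := ⟨∅, by simp, by simp⟩
      lower := fun h ⟨T, hT, hb⟩ => ⟨T, hT, h.trans hb⟩
      sup_mem := by
        classical
        rintro a b ⟨T, hT, ha⟩ ⟨T', hT', hb⟩
        refine ⟨T ∪ T', fun t ht => ?_, ?_⟩
        · rcases Finset.mem_union.1 ht with h | h
          exacts [hT t h, hT' t h]
        · rw [Finset.sup_union]
          exact sup_le_sup ha hb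
      round := by
        classical
        rintro a ⟨T, hT, ha⟩
        suffices h : ∃ T' : Finset B, (∀ t ∈ T', ∃ I ∈ S, t ∈ I.carrier) ∧
            prec (T.sup id) (T'.sup id) by
          obtain ⟨T', hT', h⟩ := h
          exact ⟨T'.sup id, ⟨T', hT', le_rfl⟩, IsProximity.mono ha h le_rfl⟩
        clear ha
        induction T using Finset.induction_on with
        | empty => exact ⟨∅, by simp, by simpa using IsProximity.bot⟩
        | insert t T _ ih =>
          obtain ⟨T', hT', h⟩ := ih fun s hs => hT s (Finset.mem_insert_of_mem hs)
          obtain ⟨I, hI, ht⟩ := hT t (Finset.mem_insert_self t T)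
          obtain ⟨t', ht', htt⟩ := I.round ht
          refine ⟨insert t' T', fun s hs => ?_, ?_⟩
          · rcases Finset.mem_insert.1 hs with rfl | hs
            exacts [⟨I, hI, ht'⟩, hT' s hs]
          · rw [Finset.sup_insert, Finset.sup_insert]
            exact IsProximity.sup_sup htt h }

theorem mem_sSup {S : Set (RoundIdeal prec)} {a : B} : a ∈ (sSup S).carrier ↔
    ∃ T : Finset B, (∀ t ∈ T, ∃ I ∈ S, t ∈ I.carrier) ∧ a ≤ T.sup id := Iff.rfl

theorem isLUB_sSup (S : Set (RoundIdeal prec)) : IsLUB S (sSup S) := by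
  refine ⟨fun I hI a ha => ⟨{a}, ?_, by simp⟩, fun J hJ a ⟨T, hT, ha⟩ => ?_⟩
  · simpa using ⟨I, hI, ha⟩
  · refine J.lower ha (J.finset_sup_mem fun t ht => ?_)
    obtain ⟨I, hI, h⟩ := hT t ht
    exact hJ hI h

instance : Min (RoundIdeal prec) where
  min I J :=
    { carrier := I.carrier ∩ J.carrier
      bot_mem := ⟨I.bot_mem, J.bot_mem⟩
      lower := fun h hb => ⟨I.lower h hb.1, J.lower h hb.2⟩
      sup_mem := fun ha hb => ⟨I.sup_mem ha.1 hb.1, J.sup_mem ha.2 hb.2⟩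
      round := fun ⟨hI, hJ⟩ => by
        obtain ⟨b, hb, hab⟩ := I.round hI
        obtain ⟨c, hc, hac⟩ := J.round hJ
        exact ⟨b ⊓ c, ⟨I.lower inf_le_left hb, J.lower inf_le_right hc⟩,
          IsProximity.inf hab hac⟩ }

instance : CompleteLattice (RoundIdeal prec) where
  __ := completeLatticeOfSup (RoundIdeal prec) isLUB_sSup
  -- Keeps meets definitionally equal to intersections of carriers.
  inf := (· ⊓ ·)
  inf_le_left _ _ := Set.inter_subset_left
  inf_le_right _ _ := Set.inter_subset_right
  le_inf _ _ _ := Set.subset_inter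

instance : Order.Frame (RoundIdeal prec) :=
  .ofMinimalAxioms
    { inf_sSup_le_iSup_inf := by
        classical
        rintro I S a ⟨ha, T, hT, haT⟩
        have h : a = T.sup fun t => a ⊓ t := by
          exact (inf_eq_left.2 haT).symm.trans (Finset.sup_inf_distrib_left T id a)
        rw [h]
        refine Finset.sup_induction (bot_mem _) (fun _ h₁ _ h₂ => sup_mem _ h₁ h₂) fun t ht => ?_
        obtain ⟨J, hJ, htJ⟩ := hT t ht
        exact le_iSup₂ (f := fun J (_ : J ∈ S) => I ⊓ J) J hJ
          ⟨I.lower inf_le_left ha, J.lower inf_le_right htJ⟩ }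

theorem eq_top_iff_mem {I : RoundIdeal prec} : I = ⊤ ↔ ⊤ ∈ I.carrier := by
  constructor
  · rintro rfl
    -- The lattice's `⊤` is not given by an explicit carrier, so it is compared with the ideal of
    -- all elements, which is round because `⊤ ≺ ⊤` is dual to `⊥ ≺ ⊥`.
    let J : RoundIdeal prec := ⟨Set.univ, trivial, fun _ _ => trivial, fun _ _ => trivial,
      fun {a} _ => ⟨⊤, trivial, IsProximity.mono le_top
        (by simpa using IsProximity.compl (IsProximity.bot (prec := prec))) le_rfl⟩⟩
    exact le_def.1 (le_top : J ≤ ⊤) trivial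
  · exact fun h => top_le_iff.1 fun _ _ => I.lower le_top h

theorem mem_bot {a : B} : a ∈ (⊥ : RoundIdeal prec).carrier ↔ a = ⊥ := by
  refine ⟨fun h => ?_, fun h => h ▸ bot_mem _⟩
  let J : RoundIdeal prec := ⟨{⊥}, rfl, fun h hb => by simp_all,
    fun ha hb => by simp_all, fun ha => ⟨⊥, rfl, by
      rw [Set.mem_singleton_iff.1 ha]; exact IsProximity.bot⟩⟩
  exact le_def.1 (bot_le : ⊥ ≤ J) h

theorem mem_sup {I J : RoundIdeal prec} {a : B} :
    a ∈ (I ⊔ J).carrier ↔ ∃ b ∈ I.carrier, ∃ c ∈ J.carrier, a ≤ b ⊔ c := by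
  constructor
  · let K : RoundIdeal prec :=
      { carrier := {a | ∃ b ∈ I.carrier, ∃ c ∈ J.carrier, a ≤ b ⊔ c}
        bot_mem := ⟨⊥, I.bot_mem, ⊥, J.bot_mem, bot_le⟩
        lower := fun h ⟨b, hb, c, hc, h'⟩ => ⟨b, hb, c, hc, h.trans h'⟩
        sup_mem := fun ⟨b, hb, c, hc, h⟩ ⟨b', hb', c', hc', h'⟩ =>
          ⟨b ⊔ b', I.sup_mem hb hb', c ⊔ c', J.sup_mem hc hc',
            (sup_le_sup h h').trans_eq (sup_sup_sup_comm ..)⟩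
        round := fun ⟨b, hb, c, hc, h⟩ => by
          obtain ⟨b', hb', hbb⟩ := I.round hb
          obtain ⟨c', hc', hcc⟩ := J.round hc
          exact ⟨b' ⊔ c', ⟨b', hb', c', hc', le_rfl⟩,
            IsProximity.mono h (IsProximity.sup_sup hbb hcc) le_rfl⟩ }
    have hI : I ≤ K := fun b hb => ⟨b, hb, ⊥, J.bot_mem, le_sup_left⟩
    have hJ : J ≤ K := fun c hc => ⟨⊥, I.bot_mem, c, hc, le_sup_right⟩
    exact fun h => le_def.1 (sup_le hI hJ) h
  · rintro ⟨b, hb, c, hc, h⟩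
    exact lower _ h (sup_mem _ (le_def.1 le_sup_left hb) (le_def.1 le_sup_right hc))

/-- The round ideal of the elements `b ≺ a`. -/
def below (prec : B → B → Prop) [IsProximity prec] (a : B) : RoundIdeal prec where
  carrier := {b | prec b a}
  bot_mem := IsProximity.mono le_rfl IsProximity.bot bot_le
  lower h hb := IsProximity.mono h hb le_rfl
  sup_mem := IsProximity.sup
  round h := by
    obtain ⟨c, hc, hca⟩ := IsProximity.interp h
    exact ⟨c, hca, hc⟩

theorem isCompactFrame : IsCompactFrame (RoundIdeal prec) := by
  intro S hS
  obtain ⟨T, hT, hle⟩ := mem_sSup.1 (eq_top_iff_mem.1 hS)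
  choose! f hf using hT
  refine ⟨f '' T, ?_, T.finite_toSet.image f, eq_top_iff_mem.2 ?_⟩
  · rintro _ ⟨t, ht, rfl⟩
    exact (hf t ht).1
  · exact ⟨T, fun t ht => ⟨f t, ⟨t, ht, rfl⟩, (hf t ht).2⟩, hle⟩

/-- If `a ≺ b` with `b ∈ I`, then `bᶜ ≺ aᶜ`. The ideal below `aᶜ` is disjoint from the one below
`a`, so `⊤ = b ⊔ bᶜ` lies in the required join. -/
theorem ratherBelow_below {I : RoundIdeal prec} {a : B} (ha : a ∈ I.carrier) :
    RatherBelow (below prec a) I := by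
  obtain ⟨b, hb, hab⟩ := I.round ha
  have h : below prec aᶜ ≤ (below prec a)ᶜ := by
    rw [le_compl_iff_disjoint_left, disjoint_iff_inf_le]
    rintro c ⟨hc, hc'⟩
    rw [mem_bot, ← le_bot_iff, ← inf_compl_eq_bot (a := a)]
    exact le_inf (IsProximity.le hc) (IsProximity.le hc')
  refine eq_top_iff_mem.2 (mem_sup.2 ⟨b, hb, bᶜ, le_def.1 h (IsProximity.compl hab), ?_⟩)
  rw [sup_compl_eq_top]

theorem isRegularFrame : IsRegularFrame (RoundIdeal prec) := by
  intro I
  apply le_antisymm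
  · intro a ha
    obtain ⟨b, hb, hab⟩ := I.round ha
    have hle : below prec b ≤ sSup {J | RatherBelow J I} := le_sSup (ratherBelow_below hb)
    exact hle hab
  · refine sSup_le fun J hJ => ?_
    have hJ : I ⊔ Jᶜ = ⊤ := hJ
    calc J = J ⊓ (I ⊔ Jᶜ) := by rw [hJ, inf_top_eq]
      _ ≤ I := by rw [inf_sup_left, inf_compl_self, sup_bot_eq]; exact inf_le_right

end RoundIdeal

end RoundIdeals

/-! ### Specialization order and regular open sets -/

section RegularOpens

variable {X : Type u} [TopologicalSpace X]

theorem SpecLE.refl (x : X) : SpecLE x x := fun _ _ h => h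

theorem subset_downSet (U : Set X) : U ⊆ downSet U := fun x hx => ⟨x, hx, SpecLE.refl x⟩

theorem downSet_mono {U V : Set X} (h : U ⊆ V) : downSet U ⊆ downSet V :=
  fun _ ⟨y, hy, hxy⟩ => ⟨y, h hy, hxy⟩

theorem upInterior_subset (U : Set X) : upInterior U ⊆ U := fun x hx => hx x (SpecLE.refl x)

theorem upInterior_mono {U V : Set X} (h : U ⊆ V) : upInterior U ⊆ upInterior V :=
  fun _ hx y hxy => h (hx y hxy)

theorem IsOpen.upInterior_eq {U : Set X} (hU : IsOpen U) : upInterior U = U :=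
  (upInterior_subset U).antisymm fun _ hx _ hxy => hxy U hU hx

theorem upInterior_compl (U : Set X) : upInterior Uᶜ = (downSet U)ᶜ := by
  ext x
  simp only [upInterior, downSet, Set.mem_compl_iff, Set.mem_ofPred_eq]
  exact ⟨fun h ⟨y, hy, hxy⟩ => h y hxy hy, fun h _ hxy hy => h ⟨_, hy, hxy⟩⟩

namespace TopologicalSpace.Opens

theorem coe_compl_eq (U : Opens X) : ((Uᶜ : Opens X) : Set X) = (closure (U : Set X))ᶜ := by
  rw [coe_compl_eq_interior_compl, _root_.interior_compl]

end TopologicalSpace.Opens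

namespace RO

theorem isOpen_toSet (U : RO X) : IsOpen U.toSet := (U : Opens X).isOpen

theorem le_iff {U V : RO X} : U ≤ V ↔ U.toSet ⊆ V.toSet := Heyting.Regular.coe_le_coe.symm

theorem toSet_injective : Function.Injective (toSet : RO X → Set X) := fun _ _ h =>
  (le_iff.2 h.subset).antisymm (le_iff.2 h.superset)

theorem toSet_compl (U : RO X) : (Uᶜ).toSet = (closure U.toSet)ᶜ := by
  rw [toSet, Heyting.Regular.coe_compl, Opens.coe_compl_eq]; rfl

theorem toSet_inf (U V : RO X) : (U ⊓ V).toSet = U.toSet ∩ V.toSet := by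
  rw [toSet, Heyting.Regular.coe_inf]; rfl

theorem toSet_sup (U V : RO X) : (U ⊔ V).toSet = interior (closure (U.toSet ∪ V.toSet)) := by
  rw [toSet, Heyting.Regular.coe_sup, Opens.coe_compl_eq, Opens.coe_compl_eq, closure_compl,
    compl_compl]
  rfl

theorem toSet_bot : (⊥ : RO X).toSet = ∅ := rfl

theorem interior_closure_toSet (U : RO X) : interior (closure U.toSet) = U.toSet := by
  have h := toSet_sup U U
  rwa [sup_idem, Set.union_self, eq_comm] at h

/-- The regular open set `interior (closure U)` generated by an open set `U`. -/
def gen (U : Opens X) : RO X := Heyting.Regular.toRegular U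

theorem toSet_gen (U : Opens X) : (gen U).toSet = interior (closure (U : Set X)) := by
  rw [toSet, gen, Heyting.Regular.coe_toRegular, Opens.coe_compl_eq, Opens.coe_compl_eq,
    closure_compl, compl_compl]

theorem isRegularClosed_compl (U : RO X) : IsRegularClosed (U.toSet)ᶜ := by
  rw [IsRegularClosed, interior_compl, closure_compl, interior_closure_toSet]

theorem mem_nhd_of_le {x : X} {U V : RO X} (hUV : U ≤ V) (hU : U ∈ nhd x) : V ∈ nhd x :=
  le_iff.1 hUV hU

theorem inf_mem_nhd {x : X} {U V : RO X} (hU : U ∈ nhd x) (hV : V ∈ nhd x) : U ⊓ V ∈ nhd x := by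
  change x ∈ (U ⊓ V).toSet
  rw [toSet_inf]
  exact ⟨hU, hV⟩

end RO

end RegularOpens

/-! ### From a `dV`-space to its frame of round ideals -/

namespace IsDVSpace

variable {X : Type u} [TopologicalSpace X]

theorem wellBelow_le (h : IsDVSpace X) {U V : RO X} (hUV : U.WellBelow V) : U ≤ V := by
  have hle := upInterior_mono (subset_closure.trans hUV)
  rw [U.isOpen_toSet.upInterior_eq, h.orderRegular V] at hle
  exact RO.le_iff.2 hle

/-- As `V = ⇑↓V`, a point outside `V` lies below some point outside `↓V`, and that point is outside
the closure of `U`. -/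
theorem wellBelow_compl (h : IsDVSpace X) {U V : RO X} (hUV : U.WellBelow V) :
    (Vᶜ).WellBelow Uᶜ := by
  unfold RO.WellBelow at hUV ⊢
  rw [RO.toSet_compl, RO.toSet_compl, closure_compl, RO.interior_closure_toSet]
  intro x hx
  rw [← h.orderRegular V, Set.mem_compl_iff] at hx
  simp only [upInterior, Set.mem_ofPred_eq, not_forall] at hx
  obtain ⟨y, hxy, hy⟩ := hx
  exact ⟨y, fun hyU => hy (hUV hyU), hxy⟩

/-- Order-normality is applied to the closure of `U` and the complement of `V`, whose `⇑` is the
complement of `↓V`. The interpolant is the regularization of the first open set obtained. -/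
theorem wellBelow_interp (h : IsDVSpace X) {U V : RO X} (hUV : U.WellBelow V) :
    ∃ W : RO X, U.WellBelow W ∧ W.WellBelow V := by
  have hd : Disjoint (closure U.toSet) (upInterior (V.toSet)ᶜ) := by
    rw [upInterior_compl, Set.disjoint_compl_right_iff_subset]
    exact hUV
  obtain ⟨P, Q, hP, hQ, hPQ, hUP, hVQ⟩ :=
    h.orderNormal _ _ isClosed_closure V.isRegularClosed_compl hd
  refine ⟨RO.gen ⟨P, hP⟩, hUP.trans (downSet_mono ?_), ?_⟩
  · rw [RO.toSet_gen]
    exact hP.subset_interior_closure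
  · rw [upInterior_compl, Set.compl_subset_comm] at hVQ
    have hcl : closure (RO.gen ⟨P, hP⟩).toSet ⊆ closure P := by
      rw [RO.toSet_gen]
      exact closure_minimal interior_subset isClosed_closure
    exact (hcl.trans (closure_minimal hPQ.subset_compl_right hQ.isClosed_compl)).trans hVQ

theorem isProximity (h : IsDVSpace X) : IsProximity (RO.WellBelow (X := X)) where
  bot := by simp [RO.WellBelow, RO.toSet_bot]
  le := h.wellBelow_le
  mono hab hbc hcd := (closure_mono (RO.le_iff.1 hab)).trans
    (Set.Subset.trans hbc (downSet_mono (RO.le_iff.1 hcd)))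
  sup {U V W} hU hV := by
    refine (closure_minimal (s := (U ⊔ V).toSet) ?_ isClosed_closure).trans
      ((closure_union (s := U.toSet) (t := V.toSet)).trans_subset (Set.union_subset hU hV))
    rw [RO.toSet_sup]
    exact interior_subset
  compl := h.wellBelow_compl
  interp := h.wellBelow_interp

theorem exists_wellBelow (h : IsDVSpace X) {x : X} {U : RO X} (hU : U ∈ RO.nhd x) :
    ∃ V ∈ RO.nhd x, V.WellBelow U := by
  rw [← (h.concordant x).2] at hU
  exact hU.2

theorem exists_regularOpen_subset (h : IsDVSpace X) {x : X} {U : Set X} (hU : IsOpen U)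
    (hx : x ∈ U) :
    ∃ V : RO X, x ∈ V.toSet ∧ V.toSet ⊆ U := by
  obtain ⟨V, hV, hxV, hVU⟩ := Opens.isBasis_iff_nbhd.1 h.basis (U := ⟨U, hU⟩) hx
  exact ⟨⟨V, hV⟩, hxV, hVU⟩

theorem eq_of_nhd_eq (h : IsDVSpace X) {x y : X} (hxy : RO.nhd x = RO.nhd y) : x = y := by
  have := h.t0
  refine Inseparable.eq (inseparable_iff_forall_isOpen.2 fun U hU => ⟨fun hx => ?_, fun hy => ?_⟩)
  · obtain ⟨V, hV, hVU⟩ := h.exists_regularOpen_subset hU hx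
    exact hVU (hxy.subset hV)
  · obtain ⟨V, hV, hVU⟩ := h.exists_regularOpen_subset hU hy
    exact hVU (hxy.superset hV)

/-- The round ideal of the regular open sets `U` whose complement in `RO X` contains `x`. -/
def pointIdeal (h : IsDVSpace X) (x : X) : RoundIdeal (RO.WellBelow (X := X)) where
  carrier := {U | Uᶜ ∈ RO.nhd x}
  bot_mem := by
    rw [Set.mem_ofPred_eq, compl_bot]
    exact Set.mem_univ x
  lower hUV hV := RO.mem_nhd_of_le (compl_le_compl hUV) hV
  sup_mem hU hV := by
    rw [Set.mem_ofPred_eq, compl_sup]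
    exact RO.inf_mem_nhd hU hV
  round {U} hU := by
    obtain ⟨V, hV, hVU⟩ := h.exists_wellBelow hU
    refine ⟨Vᶜ, ?_, ?_⟩
    · rwa [Set.mem_ofPred_eq, compl_compl]
    · rw [← compl_compl U]
      exact h.wellBelow_compl hVU

theorem mem_pointIdeal (h : IsDVSpace X) {x : X} {U : RO X} :
    U ∈ (h.pointIdeal x).carrier ↔ Uᶜ ∈ RO.nhd x :=
  Iff.rfl

theorem pointIdeal_injective (h : IsDVSpace X) : Function.Injective h.pointIdeal := by
  intro x y hxy
  refine h.eq_of_nhd_eq (Set.ext fun U => ?_)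
  have := congrArg (Uᶜ ∈ RoundIdeal.carrier ·) hxy
  simpa only [mem_pointIdeal, compl_compl, eq_iff_iff] using this

/-- The complements of the members of `I` form a proper filter, and roundness of `I` says that
passing to the round part loses nothing. The point realizing this filter is the one sought. -/
theorem exists_pointIdeal_eq (h : IsDVSpace X) {I : RoundIdeal (RO.WellBelow (X := X))}
    (hI : ⊤ ∉ I.carrier) : ∃ x, h.pointIdeal x = I := by
  have hF : IsProperFilter {U : RO X | Uᶜ ∈ I.carrier} := by
    refine ⟨Order.IsPFilter.of_def ⟨⊤, ?_⟩ ?_ ?_, ?_⟩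
    · simpa using I.bot_mem
    · refine fun U hU V hV => ⟨U ⊓ V, ?_, inf_le_left, inf_le_right⟩
      have hc : (U ⊓ V)ᶜ = Uᶜ ⊔ Vᶜ := compl_inf
      rw [Set.mem_ofPred_eq, hc]
      exact I.sup_mem hU hV
    · exact fun hUV hU => I.lower (compl_le_compl hUV) hU
    · simpa using hI
  obtain ⟨x, hx⟩ := h.realized _ hF
  refine ⟨x, RoundIdeal.eq_of_carrier_eq (Set.ext fun U => ?_)⟩
  rw [mem_pointIdeal, ← hx]
  constructor
  · rintro ⟨hU, -⟩
    rwa [Set.mem_ofPred_eq, compl_compl] at hU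
  · intro hU
    obtain ⟨V, hV, hUV⟩ := I.round hU
    exact ⟨by rwa [Set.mem_ofPred_eq, compl_compl], Vᶜ, by rwa [Set.mem_ofPred_eq, compl_compl],
      h.wellBelow_compl hUV⟩

theorem top_notMem_pointIdeal (h : IsDVSpace X) (x : X) : ⊤ ∉ (h.pointIdeal x).carrier := by
  rw [mem_pointIdeal, compl_top]
  exact Set.notMem_empty x

theorem sup_pointIdeal_eq_top (h : IsDVSpace X) [IsProximity (RO.WellBelow (X := X))]
    {J : RoundIdeal (RO.WellBelow (X := X))} {x : X} :
    J ⊔ h.pointIdeal x = ⊤ ↔ ∃ U ∈ J.carrier, x ∈ U.toSet := by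
  rw [RoundIdeal.eq_top_iff_mem, RoundIdeal.mem_sup]
  constructor
  · rintro ⟨U, hU, V, hV, hUV⟩
    refine ⟨U, hU, RO.mem_nhd_of_le ?_ hV⟩
    rw [compl_le_iff_compl_le, ← codisjoint_iff_compl_le_right, codisjoint_iff_le_sup]
    exact hUV
  · rintro ⟨U, hU, hx⟩
    refine ⟨U, hU, Uᶜ, ?_, sup_compl_eq_top.ge⟩
    rw [mem_pointIdeal, compl_compl]
    exact hx

theorem nonempty_homeomorph (h : IsDVSpace X) [IsProximity (RO.WellBelow (X := X))] :
    Nonempty (X ≃ₜ UpperVietoris (RoundIdeal (RO.WellBelow (X := X)))) := by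
  let f : X → UpperVietoris (RoundIdeal (RO.WellBelow (X := X))) := fun x =>
    ⟨h.pointIdeal x, fun e => h.top_notMem_pointIdeal x (RoundIdeal.eq_top_iff_mem.1 e)⟩
  have hpre (J : RoundIdeal (RO.WellBelow (X := X))) :
      f ⁻¹' UpperVietoris.box J = ⋃ U ∈ J.carrier, U.toSet := by
    ext x
    rw [Set.mem_iUnion₂]
    exact h.sup_pointIdeal_eq_top.trans (by simp only [exists_prop])
  have hf : Function.Bijective f := by
    refine ⟨fun x y hxy => h.pointIdeal_injective (congrArg Subtype.val hxy), fun I => ?_⟩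
    obtain ⟨x, hx⟩ := h.exists_pointIdeal_eq fun e => I.2 (RoundIdeal.eq_top_iff_mem.2 e)
    exact ⟨x, Subtype.ext hx⟩
  refine ⟨(Equiv.ofBijective f hf).toHomeomorphOfIsInducing ⟨le_antisymm ?_ ?_⟩⟩
  · refine continuous_iff_le_induced.1 (continuous_generateFrom_iff.2 ?_)
    rintro _ ⟨J, rfl⟩
    change IsOpen (f ⁻¹' _)
    rw [hpre]
    exact isOpen_biUnion fun U _ => U.isOpen_toSet
  · intro U hU
    refine (@isOpen_iff_forall_mem_open X (induced f _) U).2 fun x hx => ?_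
    obtain ⟨V, hxV, hVU⟩ := h.exists_regularOpen_subset hU hx
    obtain ⟨W, hxW, hWV⟩ := h.exists_wellBelow hxV
    -- The preimage is the union of all `W ≪ V`: it stays inside `V`, and it contains `x` by
    -- concordance.
    refine ⟨f ⁻¹' UpperVietoris.box (RoundIdeal.below _ V), ?_,
      ⟨_, isOpen_generateFrom_of_mem ⟨_, rfl⟩, rfl⟩, ?_⟩
    · rw [hpre]
      exact Set.iUnion₂_subset fun W hW => (RO.le_iff.1 (h.wellBelow_le hW)).trans hVU
    · rw [hpre]
      exact Set.mem_biUnion (x := W) hWV hxW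

end IsDVSpace

/-! ### Rather below relation and compactness in frames -/

section CompactRegularFrames

variable {L : Type u} [Order.Frame L]

theorem ratherBelow_def {a b : L} : RatherBelow a b ↔ b ⊔ aᶜ = ⊤ := Iff.rfl

namespace RatherBelow

theorem le_of_compl_le {a b : L} (h : a ⊔ bᶜ = ⊤) : b ≤ a :=
  calc b = b ⊓ (a ⊔ bᶜ) := by rw [h, inf_top_eq]
    _ ≤ a := by rw [inf_sup_left, inf_compl_self, sup_bot_eq]; exact inf_le_right

theorem le {a b : L} (h : RatherBelow a b) : a ≤ b := le_of_compl_le h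

theorem bot (a : L) : RatherBelow ⊥ a := by simp [RatherBelow]

theorem sup {a b c : L} (ha : RatherBelow a c) (hb : RatherBelow b c) :
    RatherBelow (a ⊔ b) c := by
  rw [ratherBelow_def] at *
  rw [compl_sup, sup_inf_left, ha, hb, inf_top_eq]

theorem compl_compl {a b : L} (h : RatherBelow a b) : RatherBelow aᶜᶜ b := by
  rwa [ratherBelow_def, compl_compl_compl]

end RatherBelow

theorem IsCompactFrame.top_mem_of_directedOn (hc : IsCompactFrame L) {S : Set L}
    (hne : S.Nonempty) (hdir : DirectedOn (· ≤ ·) S) (hS : sSup S = ⊤) : ⊤ ∈ S := by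
  obtain ⟨T, hTS, hT, hTop⟩ := hc S hS
  obtain ⟨a, ha, hle⟩ : ∃ a ∈ S, ∀ t ∈ T, t ≤ a := by
    clear hTop
    induction T, hT using Set.Finite.induction_on with
    | empty => exact ⟨hne.some, hne.some_mem, by simp⟩
    | @insert t T _ _ ih =>
      obtain ⟨a, ha, hle⟩ := ih ((Set.subset_insert _ _).trans hTS)
      obtain ⟨b, hb, hab, htb⟩ := hdir a ha t (hTS (Set.mem_insert _ _))
      refine ⟨b, hb, fun s hs => ?_⟩
      rcases hs with rfl | hs
      exacts [htb, (hle s hs).trans hab]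
  rwa [← top_le_iff.1 (hTop.ge.trans (sSup_le hle))]

theorem exists_sup_eq_top_of_directedOn (hc : IsCompactFrame L) {S : Set L} {c : L}
    (hne : S.Nonempty) (hdir : DirectedOn (· ≤ ·) S) (hS : sSup S ⊔ c = ⊤) :
    ∃ b ∈ S, b ⊔ c = ⊤ := by
  refine hc.top_mem_of_directedOn (S := (· ⊔ c) '' S) (hne.image _) ?_ ?_
  · rintro _ ⟨a, ha, rfl⟩ _ ⟨b, hb, rfl⟩
    obtain ⟨d, hd, had, hbd⟩ := hdir a ha b hb
    exact ⟨_, ⟨d, hd, rfl⟩, sup_le_sup_right had c, sup_le_sup_right hbd c⟩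
  · refine top_le_iff.1 (hS.ge.trans (sup_le (sSup_le fun b hb => ?_) ?_))
    · exact le_sup_left.trans (le_sSup (Set.mem_image_of_mem _ hb))
    · exact le_sup_right.trans (le_sSup (Set.mem_image_of_mem _ hne.some_mem))

theorem exists_ratherBelow_sup_eq_top (hc : IsCompactFrame L) (hr : IsRegularFrame L) {a c : L}
    (h : a ⊔ c = ⊤) : ∃ b, RatherBelow b a ∧ b ⊔ c = ⊤ := by
  rw [hr a] at h
  exact exists_sup_eq_top_of_directedOn hc ⟨⊥, RatherBelow.bot a⟩
    (fun b hb d hd => ⟨b ⊔ d, RatherBelow.sup hb hd, le_sup_left, le_sup_right⟩) h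

theorem IsRegularFrame.le_of_forall (hr : IsRegularFrame L) {a c : L}
    (h : ∀ b, RatherBelow b a → b ≤ c) : a ≤ c := by
  rw [hr a]
  exact sSup_le h

end CompactRegularFrames

/-! ### The upper Vietoris space of a compact regular frame is a `dV`-space -/

namespace UpperVietoris

variable {L : Type u} [Order.Frame L]

theorem mem_box {a : L} {c : UpperVietoris L} : c ∈ box a ↔ a ⊔ c.1 = ⊤ := Iff.rfl

theorem mk_mem_box {a b : L} {hb : b ≠ ⊤} :
    (⟨b, hb⟩ : UpperVietoris L) ∈ box a ↔ a ⊔ b = ⊤ := Iff.rfl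

theorem isOpen_box (a : L) : IsOpen (box a) := isOpen_generateFrom_of_mem ⟨a, rfl⟩

theorem box_mono {a b : L} (h : a ≤ b) : box a ⊆ box b := fun _ hc =>
  top_le_iff.1 ((mem_box.1 hc).ge.trans (sup_le_sup_right h _))

theorem box_inf (a b : L) : box (a ⊓ b) = box a ∩ box b := by
  ext c
  rw [Set.mem_inter_iff, mem_box, mem_box, mem_box, sup_inf_right, inf_eq_top_iff]

theorem box_top : box (⊤ : L) = Set.univ :=
  Set.eq_univ_of_forall fun c => mem_box.2 (top_sup_eq c.1)

theorem isTopologicalBasis_box : IsTopologicalBasis (Set.range (box (L := L))) := by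
  refine isTopologicalBasis_of_subbasis_of_finiteInter rfl ⟨⟨⊤, box_top⟩, ?_⟩
  rintro _ ⟨a, rfl⟩ _ ⟨b, rfl⟩
  exact ⟨a ⊓ b, box_inf a b⟩

theorem exists_box_subset {U : Set (UpperVietoris L)} (hU : IsOpen U) {c : UpperVietoris L}
    (hc : c ∈ U) : ∃ a, c ∈ box a ∧ box a ⊆ U := by
  obtain ⟨_, ⟨a, rfl⟩, h⟩ := isTopologicalBasis_box.exists_subset_of_mem_open hc hU
  exact ⟨a, h⟩

/-- A box containing the point `⊥` is the box of `⊤`, so one member of any open cover is the whole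
space. If `⊥ = ⊤`, the space is empty. -/
theorem compactSpace : CompactSpace (UpperVietoris L) := by
  refine ⟨isCompact_of_finite_subcover fun {ι} U hU hcov => ?_⟩
  by_cases hL : (⊥ : L) = ⊤
  · exact ⟨∅, fun c _ => (c.2 (top_le_iff.1 (hL.ge.trans bot_le))).elim⟩
  obtain ⟨i, hi⟩ := Set.mem_iUnion.1 (hcov (Set.mem_univ (⟨⊥, hL⟩ : UpperVietoris L)))
  refine ⟨{i}, fun c _ => Set.mem_biUnion (Finset.mem_singleton_self i) ?_⟩
  obtain ⟨a, ha, haU⟩ := exists_box_subset (hU i) hi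
  have ha : a = ⊤ := (sup_bot_eq a).symm.trans (mk_mem_box.1 ha)
  exact haU (ha ▸ mem_box.2 (top_sup_eq c.1))

/-- For `b` rather below `c`, the box of `bᶜ` contains `c`; if it also contains `d`, then `b ≤ d`.
Regularity makes `c` the join of such `b`. -/
theorem specLE_iff (hr : IsRegularFrame L) {c d : UpperVietoris L} :
    SpecLE c d ↔ c.1 ≤ d.1 := by
  constructor
  · intro h
    refine hr.le_of_forall fun b hb => RatherBelow.le_of_compl_le ?_
    rw [ratherBelow_def, sup_comm] at hb
    rw [sup_comm]
    exact h _ (isOpen_box bᶜ) hb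
  · intro h U hU hc
    obtain ⟨a, ha, haU⟩ := exists_box_subset hU hc
    exact haU (top_le_iff.1 ((mem_box.1 ha).ge.trans (sup_le_sup_left h a)))

theorem t0Space (hr : IsRegularFrame L) : T0Space (UpperVietoris L) := by
  refine ⟨fun c d h => Subtype.ext (le_antisymm ?_ ?_)⟩
  · exact (specLE_iff hr).1 fun U hU => (h.mem_open_iff hU).1
  · exact (specLE_iff hr).1 fun U hU => (h.mem_open_iff hU).2

theorem mem_downSet_box (hr : IsRegularFrame L) {a : L} {c : UpperVietoris L} :
    c ∈ downSet (box a) ↔ ¬ a ≤ c.1 := by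
  constructor
  · rintro ⟨d, hd, hcd⟩ hac
    rw [specLE_iff hr] at hcd
    exact d.2 ((sup_eq_right.2 (hac.trans hcd)).symm.trans (mem_box.1 hd))
  · intro h
    obtain ⟨b, hb, hbc⟩ : ∃ b, RatherBelow b a ∧ ¬ b ≤ c.1 := by
      by_contra! hcon
      exact h (hr.le_of_forall hcon)
    -- `c ⊔ bᶜ` is proper because `b ≰ c`, and it lies in `□ a` because `b` is rather below `a`.
    refine ⟨⟨c.1 ⊔ bᶜ, fun e => hbc (RatherBelow.le_of_compl_le e)⟩, ?_,
      (specLE_iff hr).2 le_sup_left⟩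
    refine mk_mem_box.2 ?_
    rw [sup_left_comm, ratherBelow_def.1 hb, sup_top_eq]

theorem box_eq_empty_iff (hr : IsRegularFrame L) {a : L} : box a = ∅ ↔ a = ⊥ := by
  constructor
  · intro h
    rw [← le_bot_iff]
    refine hr.le_of_forall fun b hb => ?_
    by_contra hne
    have hbc : bᶜ ≠ ⊤ := fun e => hne (RatherBelow.le_of_compl_le ((bot_sup_eq _).trans e))
    exact (h.subset (show (⟨bᶜ, hbc⟩ : UpperVietoris L) ∈ box a from hb)).elim
  · rintro rfl
    exact Set.eq_empty_of_forall_notMem fun c hc => c.2 (by rwa [mem_box, bot_sup_eq] at hc)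

/-- The basic open set `□ a` as an element of the frame of open sets. -/
def openBox (a : L) : Opens (UpperVietoris L) := ⟨box a, isOpen_box a⟩

theorem openBox_eq_bot_iff (hr : IsRegularFrame L) {a : L} : openBox a = ⊥ ↔ a = ⊥ := by
  rw [← box_eq_empty_iff hr, ← Opens.coe_eq_empty]; rfl

theorem openBox_inf (a b : L) : openBox (a ⊓ b) = openBox a ⊓ openBox b :=
  Opens.ext (box_inf a b)

theorem disjoint_openBox_iff (hr : IsRegularFrame L) {a b : L} :
    Disjoint (openBox a) (openBox b) ↔ Disjoint a b := by
  rw [disjoint_iff, ← openBox_inf, openBox_eq_bot_iff hr, disjoint_iff]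

/-- Boxes form a basis, and two boxes are disjoint exactly when their elements are. Hence every
regular open set, being a pseudo-complement, is a single box. -/
theorem compl_eq_openBox (hr : IsRegularFrame L) (U : Opens (UpperVietoris L)) :
    Uᶜ = openBox (sSup {a | openBox a ≤ U})ᶜ := by
  apply le_antisymm
  · intro c hc
    obtain ⟨b, hcb, hb⟩ := exists_box_subset (Uᶜ).isOpen hc
    refine box_mono ?_ hcb
    rw [le_compl_iff_disjoint_right, disjoint_sSup_iff]
    intro a ha
    rw [← disjoint_openBox_iff hr]
    exact disjoint_compl_left.mono (show openBox b ≤ Uᶜ from hb) ha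
  · rw [le_compl_iff_disjoint_right, disjoint_iff_inf_le]
    rintro c ⟨hc, hcU⟩
    obtain ⟨a, hca, ha⟩ := exists_box_subset U.isOpen hcU
    have hd : Disjoint (openBox (sSup {a | openBox a ≤ U})ᶜ) (openBox a) := by
      rw [disjoint_openBox_iff hr]
      exact disjoint_compl_left.mono_right (le_sSup ha)
    exact hd.le_bot ⟨hc, hca⟩

theorem compl_openBox (hr : IsRegularFrame L) (a : L) : (openBox a)ᶜ = openBox aᶜ := by
  apply le_antisymm
  · rw [compl_eq_openBox hr]
    exact box_mono (compl_le_compl (le_sSup (le_refl (openBox a))))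
  · rw [le_compl_iff_disjoint_right, disjoint_openBox_iff hr]
    exact disjoint_compl_left

theorem isRegular_openBox_compl (hr : IsRegularFrame L) (a : L) :
    Heyting.IsRegular (openBox aᶜ) := by
  rw [← compl_openBox hr]
  exact Heyting.isRegular_compl _

/-- The regular open set `□ aᶜ`. -/
def regularBox (hr : IsRegularFrame L) (a : L) : RO (UpperVietoris L) :=
  ⟨openBox aᶜ, isRegular_openBox_compl hr a⟩

theorem toSet_regularBox (hr : IsRegularFrame L) (a : L) :
    (regularBox hr a).toSet = box aᶜ := rfl

theorem exists_regularBox_eq (hr : IsRegularFrame L) (U : RO (UpperVietoris L)) :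
    ∃ a, regularBox hr a = U := by
  exact ⟨sSup {a | openBox a ≤ (U : Opens _)ᶜ}, Heyting.Regular.coe_injective
    ((compl_eq_openBox hr _).symm.trans U.prop.eq)⟩

theorem regularBox_le_iff (hr : IsRegularFrame L) {a b : L} :
    regularBox hr a ≤ regularBox hr b ↔ aᶜ ≤ bᶜ := by
  refine ⟨fun h => ?_, fun h => RO.le_iff.2 (box_mono h)⟩
  rw [le_compl_iff_disjoint_right, ← disjoint_openBox_iff hr]
  refine Disjoint.mono_left (Heyting.Regular.coe_le_coe.2 h) ?_
  exact (disjoint_openBox_iff hr).2 disjoint_compl_left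

theorem closure_box (hr : IsRegularFrame L) (a : L) : closure (box a) = (box aᶜ)ᶜ := by
  have h := Opens.coe_compl_eq (openBox a)
  rw [compl_openBox hr] at h
  exact (compl_eq_comm.1 h.symm).symm

theorem closure_box_subset_downSet_box (hr : IsRegularFrame L) {a b : L} :
    closure (box a) ⊆ downSet (box b) ↔ RatherBelow a b := by
  rw [closure_box hr]
  constructor
  · intro h
    by_contra hab
    have hne : b ≠ ⊤ := by
      rintro rfl
      exact hab (top_sup_eq _)
    -- It suffices to test the inclusion at the point `b`, which is the least point outside `↓□b`.
    refine (mem_downSet_box hr (c := ⟨b, hne⟩)).1 (h fun hb => hab ?_) le_rfl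
    rw [ratherBelow_def, sup_comm]
    exact hb
  · refine fun hab c hc => (mem_downSet_box hr).2 fun hbc => hc ?_
    rw [mem_box, sup_comm]
    exact top_le_iff.1 ((ratherBelow_def.1 hab).ge.trans (sup_le_sup_right hbc _))

theorem regularBox_wellBelow (hr : IsRegularFrame L) {a b : L} :
    (regularBox hr a).WellBelow (regularBox hr b) ↔ RatherBelow aᶜ bᶜ :=
  closure_box_subset_downSet_box hr

theorem isOrderRegularOpen_box (hr : IsRegularFrame L) (a : L) :
    IsOrderRegularOpen (box a) := by
  apply Set.Subset.antisymm
  · intro c hc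
    by_contra hac
    -- If `c ∉ □ a`, then `a ⊔ c` is a point above `c` that is outside `↓□a`.
    exact (mem_downSet_box hr).1 (hc ⟨a ⊔ c.1, hac⟩ ((specLE_iff hr).2 le_sup_right)) le_sup_left
  · intro c hc d hcd
    exact subset_downSet _ (hcd _ (isOpen_box a) hc)

theorem exists_ratherBelow_mem_box (hc : IsCompactFrame L) (hr : IsRegularFrame L) {a : L}
    {c : UpperVietoris L} (h : c ∈ box a) : ∃ b, RatherBelow bᶜ a ∧ c ∈ box bᶜ := by
  obtain ⟨b, hb, hbc⟩ := exists_ratherBelow_sup_eq_top hc hr h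
  exact ⟨bᶜ, hb.compl_compl, box_mono le_compl_compl hbc⟩

theorem isBasis_regular (hc : IsCompactFrame L) (hr : IsRegularFrame L) :
    Opens.IsBasis {U : Opens (UpperVietoris L) | Heyting.IsRegular U} := by
  refine Opens.isBasis_iff_nbhd.2 fun {U c} hcU => ?_
  obtain ⟨a, hca, ha⟩ := exists_box_subset U.isOpen hcU
  obtain ⟨b, hb, hcb⟩ := exists_ratherBelow_mem_box hc hr hca
  exact ⟨openBox bᶜ, isRegular_openBox_compl hr b, hcb, (box_mono hb.le).trans ha⟩

theorem isOrderNormal (hc : IsCompactFrame L) (hr : IsRegularFrame L) :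
    IsOrderNormal (UpperVietoris L) := by
  intro A B hA hB hAB
  obtain ⟨a, rfl⟩ : ∃ a : L, (box a)ᶜ = B := by
    refine ⟨(sSup {a | openBox a ≤ Opens.interior B})ᶜ, ?_⟩
    have h := Opens.coe_compl_eq (Opens.interior B)
    rw [compl_eq_openBox hr, Opens.coe_interior, hB] at h
    exact compl_eq_comm.1 h.symm
  rw [upInterior_compl, Set.disjoint_compl_right_iff_subset] at hAB
  rw [upInterior_compl]
  by_cases ha : a = ⊤
  · subst ha
    exact ⟨Set.univ, ∅, isOpen_univ, isOpen_empty, Set.disjoint_empty _,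
      fun _ _ => subset_downSet _ (Set.mem_univ _),
      fun c hcd => hcd (subset_downSet _ (mem_box.2 (top_sup_eq c.1)))⟩
  -- Here `⇑B` is the set of points above `a`, so only the point `a` has to be separated from `A`.
  -- Some `□ d` around `a` misses `A`; shrinking `d` to `b` rather below it gives the disjoint sets
  -- `□ bᶜ` and `□ b`.
  · obtain ⟨d, hd, hdA⟩ := exists_box_subset hA.isOpen_compl (c := ⟨a, ha⟩)
      fun h => (mem_downSet_box hr).1 (hAB h) le_rfl
    obtain ⟨b, hb, hba⟩ := exists_ratherBelow_sup_eq_top hc hr hd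
    refine ⟨box bᶜ, box b, isOpen_box _, isOpen_box _, ?_, fun c hcA => ?_, fun c hca => ?_⟩
    · rw [Set.disjoint_iff_inter_eq_empty, ← box_inf, box_eq_empty_iff hr, compl_inf_self]
    · refine (mem_downSet_box hr).2 fun hbc => hdA ?_ hcA
      exact top_le_iff.1 ((ratherBelow_def.1 hb).ge.trans (sup_le_sup_left hbc d))
    · rw [Set.mem_compl_iff, mem_downSet_box hr, not_not] at hca
      exact top_le_iff.1 (hba.ge.trans (sup_le_sup_left hca b))

theorem isConcordantFilter_nhd (hc : IsCompactFrame L) (hr : IsRegularFrame L)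
    (c : UpperVietoris L) : IsConcordantFilter RO.WellBelow (RO.nhd c) := by
  refine ⟨⟨Order.IsPFilter.of_def ⟨⊤, Set.mem_univ c⟩ ?_ RO.mem_nhd_of_le, Set.notMem_empty c⟩,
    Set.Subset.antisymm (fun _ h => h.1) fun U hU => ⟨hU, ?_⟩⟩
  · exact fun U hU V hV => ⟨U ⊓ V, RO.inf_mem_nhd hU hV, inf_le_left, inf_le_right⟩
  · obtain ⟨a, rfl⟩ := exists_regularBox_eq hr U
    obtain ⟨b, hb, hcb⟩ := exists_ratherBelow_mem_box hc hr hU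
    exact ⟨regularBox hr b, hcb, (regularBox_wellBelow hr).2 hb⟩

/-- The point is the join of the pseudo-complements of the regular elements whose boxes lie in `F`.
This join is directed, so by compactness `□ a` contains it iff some such regular element is rather
below `a`. With `a = ⊥`, properness of `F` shows that the join is not `⊤`. -/
theorem exists_nhd_eq_roundPart (hc : IsCompactFrame L) (hr : IsRegularFrame L)
    {F : Set (RO (UpperVietoris L))} (hF : IsProperFilter F) :
    ∃ c, roundPart RO.WellBelow F = RO.nhd c := by
  have hle {U V : RO (UpperVietoris L)} (hUV : U ≤ V) (hU : U ∈ F) : V ∈ F :=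
    hF.1.IsLowerSet hUV hU
  let S : Set L := {a | ∃ b, regularBox hr b ∈ F ∧ a = bᶜᶜ}
  have hne : S.Nonempty := by
    obtain ⟨U, hU⟩ := hF.1.Nonempty
    obtain ⟨b, rfl⟩ := exists_regularBox_eq hr U
    exact ⟨_, b, hU, rfl⟩
  have hdir : DirectedOn (· ≤ ·) S := by
    rintro _ ⟨a, ha, rfl⟩ _ ⟨b, hb, rfl⟩
    obtain ⟨U, hU, hUa, hUb⟩ : ∃ U ∈ F, U ≤ regularBox hr a ∧ U ≤ regularBox hr b :=
      hF.1.Directed _ ha _ hb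
    obtain ⟨d, rfl⟩ := exists_regularBox_eq hr U
    rw [regularBox_le_iff] at hUa hUb
    exact ⟨dᶜᶜ, ⟨d, hU, rfl⟩, compl_le_compl hUa, compl_le_compl hUb⟩
  have hmem {a : L} : a ⊔ sSup S = ⊤ ↔ ∃ b, regularBox hr b ∈ F ∧ RatherBelow bᶜ a := by
    constructor
    · intro h
      rw [sup_comm] at h
      obtain ⟨d, hd, hab⟩ := exists_sup_eq_top_of_directedOn hc hne hdir h
      obtain ⟨b, hb, rfl⟩ := hd
      exact ⟨b, hb, by rwa [ratherBelow_def, sup_comm]⟩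
    · rintro ⟨b, hb, hba⟩
      exact top_le_iff.1 ((ratherBelow_def.1 hba).ge.trans
        (sup_le_sup_left (le_sSup (show bᶜᶜ ∈ S from ⟨b, hb, rfl⟩)) a))
  refine ⟨⟨sSup S, fun e => ?_⟩, Set.ext fun U => ?_⟩
  · obtain ⟨b, hb, hb'⟩ := (hmem (a := ⊥)).1 (by rw [e, bot_sup_eq])
    refine hF.2 ((?_ : regularBox hr b = ⊥) ▸ hb)
    apply RO.toSet_injective
    rw [toSet_regularBox, le_bot_iff.1 hb'.le]
    exact (box_eq_empty_iff hr).2 rfl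
  · obtain ⟨a, rfl⟩ := exists_regularBox_eq hr U
    refine Iff.trans ?_ hmem.symm
    constructor
    · rintro ⟨-, V, hV, hVU⟩
      obtain ⟨b, rfl⟩ := exists_regularBox_eq hr V
      exact ⟨b, hV, (regularBox_wellBelow hr).1 hVU⟩
    · rintro ⟨b, hb, hba⟩
      exact ⟨hle ((regularBox_le_iff hr).2 hba.le) hb, _, hb, (regularBox_wellBelow hr).2 hba⟩

theorem isDVSpace (hc : IsCompactFrame L) (hr : IsRegularFrame L) :
    IsDVSpace (UpperVietoris L) where
  t0 := t0Space hr
  compact := compactSpace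
  orderNormal := isOrderNormal hc hr
  basis := isBasis_regular hc hr
  orderRegular U := by
    obtain ⟨a, rfl⟩ := exists_regularBox_eq hr U
    exact isOrderRegularOpen_box hr _
  concordant := isConcordantFilter_nhd hc hr
  realized _ := exists_nhd_eq_roundPart hc hr

end UpperVietoris

/-! ### Invariance of `dV`-spaces under homeomorphism -/

section ProperFilters

variable {B C : Type u} [BooleanAlgebra B] [BooleanAlgebra C]

theorem IsProperFilter.preimage {F : Set C} (hF : IsProperFilter F) (φ : B ≃o C) :
    IsProperFilter (φ ⁻¹' F) := by
  refine ⟨Order.IsPFilter.of_def ?_ ?_ ?_, ?_⟩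
  · obtain ⟨c, hc⟩ : F.Nonempty := hF.1.Nonempty
    exact ⟨φ.symm c, by simpa using hc⟩
  · intro a ha b hb
    obtain ⟨c, hc, hca, hcb⟩ : ∃ c ∈ F, c ≤ φ a ∧ c ≤ φ b := hF.1.Directed _ ha _ hb
    exact ⟨φ.symm c, by simpa using hc, φ.symm_apply_le.2 hca, φ.symm_apply_le.2 hcb⟩
  · exact fun {a b} hab ha => hF.1.IsLowerSet (φ.monotone hab) ha
  · simpa using hF.2

theorem roundPart_preimage {F : Set C} {prec : B → B → Prop} {prec' : C → C → Prop} (φ : B ≃o C)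
    (hφ : ∀ a b, prec' (φ a) (φ b) ↔ prec a b) :
    roundPart prec (φ ⁻¹' F) = φ ⁻¹' roundPart prec' F := by
  ext a
  refine and_congr_right fun _ => ⟨?_, ?_⟩
  · rintro ⟨b, hb, hba⟩
    exact ⟨φ b, hb, (hφ b a).2 hba⟩
  · rintro ⟨c, hc, hca⟩
    refine ⟨φ.symm c, by simpa using hc, (hφ _ _).1 ?_⟩
    rwa [φ.apply_symm_apply]

end ProperFilters

/-- An isomorphism of Heyting algebras restricts to the regular elements. -/
def OrderIso.regularCongr {α β : Type u} [HeytingAlgebra α] [HeytingAlgebra β] (φ : α ≃o β) :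
    Heyting.Regular α ≃o Heyting.Regular β where
  toFun a := ⟨φ a, by rw [Heyting.IsRegular, ← map_compl, ← map_compl, a.prop.eq]⟩
  invFun b := ⟨φ.symm b, by rw [Heyting.IsRegular, ← map_compl, ← map_compl, b.prop.eq]⟩
  left_inv a := Heyting.Regular.coe_injective (φ.symm_apply_apply _)
  right_inv b := Heyting.Regular.coe_injective (φ.apply_symm_apply _)
  map_rel_iff' := φ.le_iff_le

namespace Homeomorph

variable {X Y : Type u} [TopologicalSpace X] [TopologicalSpace Y] (e : X ≃ₜ Y)

theorem specLE_iff {x y : X} : SpecLE (e x) (e y) ↔ SpecLE x y := by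
  constructor
  · intro h U hU hx
    have := h (e.symm ⁻¹' U) (hU.preimage e.symm.continuous)
    simp only [Set.mem_preimage, symm_apply_apply] at this
    exact this hx
  · exact fun h U hU => h (e ⁻¹' U) (hU.preimage e.continuous)

theorem preimage_downSet (U : Set Y) : e ⁻¹' downSet U = downSet (e ⁻¹' U) := by
  ext x
  constructor
  · rintro ⟨y, hy, hxy⟩
    rw [← e.apply_symm_apply y] at hy hxy
    exact ⟨e.symm y, hy, e.specLE_iff.1 hxy⟩
  · rintro ⟨y, hy, hxy⟩
    exact ⟨e y, hy, e.specLE_iff.2 hxy⟩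

theorem preimage_upInterior (U : Set Y) : e ⁻¹' upInterior U = upInterior (e ⁻¹' U) := by
  have h := upInterior_compl Uᶜ
  rw [compl_compl] at h
  rw [h, Set.preimage_compl, preimage_downSet, ← upInterior_compl, Set.preimage_compl,
    compl_compl]

/-- The isomorphism of the algebras of regular open sets given by taking preimages. -/
def regularOpens : RO Y ≃o RO X := e.symm.opensCongr.regularCongr

theorem toSet_regularOpens (U : RO Y) : (e.regularOpens U).toSet = e ⁻¹' U.toSet := rfl

theorem wellBelow_iff (U V : RO Y) :
    (e.regularOpens U).WellBelow (e.regularOpens V) ↔ U.WellBelow V := by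
  unfold RO.WellBelow
  rw [toSet_regularOpens, toSet_regularOpens, ← preimage_downSet, ← preimage_closure,
    e.surjective.preimage_subset_preimage_iff]

theorem preimage_nhd (x : X) : e.regularOpens ⁻¹' RO.nhd x = RO.nhd (e x) := rfl

end Homeomorph

theorem IsDVSpace.of_homeomorph {X Y : Type u} [TopologicalSpace X] [TopologicalSpace Y]
    (h : IsDVSpace Y) (e : X ≃ₜ Y) : IsDVSpace X where
  t0 := have := h.t0; e.isEmbedding.t0Space
  compact := have := h.compact; e.symm.compactSpace
  orderNormal A B hA hB hAB := by
    obtain ⟨A, rfl⟩ := e.injective.preimage_surjective A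
    obtain ⟨B, rfl⟩ := e.injective.preimage_surjective B
    rw [IsRegularClosed, ← e.preimage_interior, ← e.preimage_closure] at hB
    rw [← e.preimage_upInterior, Set.disjoint_preimage_iff e.surjective] at hAB
    obtain ⟨U, V, hU, hV, hUV, hAU, hBV⟩ := h.orderNormal A B (e.isClosed_preimage.1 hA)
      (e.surjective.preimage_injective hB) hAB
    refine ⟨e ⁻¹' U, e ⁻¹' V, hU.preimage e.continuous, hV.preimage e.continuous,
      hUV.preimage e, ?_, ?_⟩
    · rw [← e.preimage_downSet]
      exact Set.preimage_mono hAU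
    · rw [← e.preimage_upInterior]
      exact Set.preimage_mono hBV
  basis := by
    refine Opens.isBasis_iff_nbhd.2 fun {U x} hx => ?_
    obtain ⟨V, hxV, hVU⟩ := h.exists_regularOpen_subset (U := e.symm ⁻¹' U)
      (U.isOpen.preimage e.symm.continuous) (x := e x) (by simpa using hx)
    refine ⟨e.regularOpens V, (e.regularOpens V).prop, hxV, fun z hz => ?_⟩
    simpa using hVU hz
  orderRegular U := by
    obtain ⟨U, rfl⟩ := e.regularOpens.surjective U
    rw [IsOrderRegularOpen, e.toSet_regularOpens, ← e.preimage_downSet, ← e.preimage_upInterior,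
      h.orderRegular U]
  concordant x := by
    obtain ⟨hF, hr⟩ := h.concordant (e x)
    rw [← e.preimage_nhd] at hF hr
    refine ⟨?_, e.regularOpens.surjective.preimage_injective ?_⟩
    · convert hF.preimage e.regularOpens.symm
      ext U
      simp
    · rwa [← roundPart_preimage e.regularOpens e.wellBelow_iff]
  realized F hF := by
    obtain ⟨y, hy⟩ := h.realized _ (hF.preimage e.regularOpens)
    refine ⟨e.symm y, e.regularOpens.surjective.preimage_injective ?_⟩
    rw [← roundPart_preimage e.regularOpens e.wellBelow_iff, hy, e.preimage_nhd,
      e.apply_symm_apply]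

theorem theorem6p5 (X : Type u) [TopologicalSpace X] :
    IsDVSpace X ↔
      ∃ (L : Type u) (_ : Order.Frame L),
        IsCompactFrame L ∧ IsRegularFrame L ∧ Nonempty (X ≃ₜ UpperVietoris L) := by
  constructor
  · intro h
    have := h.isProximity
    exact ⟨RoundIdeal (RO.WellBelow (X := X)), inferInstance, RoundIdeal.isCompactFrame,
      RoundIdeal.isRegularFrame, h.nonempty_homeomorph⟩
  · rintro ⟨L, _, hc, hr, ⟨e⟩⟩
    exact (UpperVietoris.isDVSpace hc hr).of_homeomorph e
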